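/- Consider a double auction with $m$ unit-demand buyers and $n$ unit-supply sellers of identical items. Buyer values are i.i.d. from a distribution $F_B$ and seller values are i.i.d. from a distribution $F_S$, all independent, where $F_B$ and $F_S$ are probability distributions supported on $[0,\infty)$. For a distribution $F$ and $q\in(0,1)$ let $F^{-1}(q)=\inf\{x : \Pr_{X\sim F}[X\le x]\ge q\}$; $F_B$ first-order stochastically dominates $F_S$ if $F_B^{-1}(q)\ge F_S^{-1}(q)$ for every $q\in(0,1)$. For a profile with ordered buyer values $b^{(1)}\ge\dots\ge b^{(m)}$ and ordered seller values $s^{(1)}\le\dots\le s^{(n)}$, put $s^{(n+1)}=\infty$ and $r=\max\{i\le\min\{m,n\} : b^{(i)}\ge s^{(i)}\}$ (with $r=0$ if there is no such $i$). The optimal (first-best) allocation trades the $r$ highest-value buyers with the $r$ lowest-value sellers. Seller Trade Reduction (STR) trades the $r$ highest-value buyers with the $r$ lowest-value sellers if $r\ge 1$ and $b^{(r)}\ge s^{(r+1)}$, and otherwise the $\max\{r-1,0\}$ highest-value buyers with the $\max\{r-1,0\}$ lowest-value sellers. The welfare of an allocation is the total value of the agents who finally hold an item, i.e. of the trading buyers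 and of the non-trading sellers. Then there is a global constant integer $c>0$ such that for all $m\ge n\ge 0$ and all such $F_B,F_S$ for which $F_B$ first-order stochastically dominates $F_S$, the expected welfare (possibly $+\infty$) of STR with $m+c$ buyers and $n+c$ sellers is at least the expected welfare of the optimal allocation with $m$ buyers and $n$ sellers. -/

import Mathlib

open MeasureTheory ProbabilityTheory

namespace DoubleAuction

/-- The value at quantile `q` of the distribution `F`: the least `x` with `Pr[X ≤ x] ≥ q`. -/
noncomputable def quantile (F : Measure ℝ) (q : ℝ) : ℝ :=
  sInf {x : ℝ | q ≤ cdf F x}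

/-- `FB` first-order stochastically dominates `FS`: at every quantile `q ∈ (0, 1)` the value of
`FB` is at least the value of `FS`. -/
def FSD (FB FS : Measure ℝ) : Prop :=
  ∀ q : ℝ, 0 < q → q < 1 → quantile FS q ≤ quantile FB q

/-- An allocation in a market with `m` buyers and `n` sellers (each seller initially holding one
item): the set of buyers who obtain an item and the set of sellers who give theirs away. -/
structure Allocation (m n : ℕ) where
  buyers : Finset (Fin m)
  sellers : Finset (Fin n)

/-- As many items are obtained as are given away. -/
def Allocation.Feasible {m n : ℕ} (A : Allocation m n) : Prop :=
  A.buyers.card = A.sellers.card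

/-- Welfare of an allocation: the total value of the agents who finally hold an item, that is, of
the trading buyers and of the sellers who do not trade. -/
noncomputable def welfare {m n : ℕ} (b : Fin m → ℝ) (s : Fin n → ℝ) (A : Allocation m n) : ℝ :=
  ∑ i ∈ A.buyers, b i + ∑ j ∈ A.sellersᶜ, s j

/-- The buyers listed by non-increasing value (ties broken by index): `buyerOrder b k` is the
buyer with the `(k + 1)`-st highest value. -/
noncomputable def buyerOrder {m : ℕ} (b : Fin m → ℝ) : Equiv.Perm (Fin m) :=
  Tuple.sort (fun i => -b i)

/-- The sellers listed by non-decreasing value (ties broken by index): `sellerOrder s k` is the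
seller with the `(k + 1)`-st lowest value. -/
noncomputable def sellerOrder {n : ℕ} (s : Fin n → ℝ) : Equiv.Perm (Fin n) :=
  Tuple.sort s

/-- The optimal trade size: the largest `k ≤ min m n` such that the `k`-th highest buyer value is
at least the `k`-th lowest seller value, and `0` if there is no such `k ≥ 1`. (The orders are
indexed from `0`, so the `k`-th agent has position `k - 1`.) -/
noncomputable def tradeSize {m n : ℕ} (b : Fin m → ℝ) (s : Fin n → ℝ) : ℕ :=
  sSup {k : ℕ | ∃ (i : Fin m) (j : Fin n), (i : ℕ) + 1 = k ∧ (j : ℕ) + 1 = k ∧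
    s (sellerOrder s j) ≤ b (buyerOrder b i)}

/-- The allocation in which the `k` highest-value buyers trade with the `k` lowest-value
sellers. -/
noncomputable def tradeTop {m n : ℕ} (b : Fin m → ℝ) (s : Fin n → ℝ) (k : ℕ) : Allocation m n where
  buyers := Finset.univ.filter fun i => (((buyerOrder b).symm i : Fin m) : ℕ) < k
  sellers := Finset.univ.filter fun j => (((sellerOrder s).symm j : Fin n) : ℕ) < k

/-- The first-best (optimal) allocation. -/
noncomputable def firstBest {m n : ℕ} (b : Fin m → ℝ) (s : Fin n → ℝ) : Allocation m n :=
  tradeTop b s (tradeSize b s)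

open Classical in
/-- The number of trades of Seller Trade Reduction. With `r` the optimal trade size, it is `r` if
there is an `(r + 1)`-st lowest seller and her value is at most the `r`-th highest buyer value;
otherwise (in particular if `r = n`, where the missing seller counts as having value `∞`) the last
trade is dropped. -/
noncomputable def strTradeSize {m n : ℕ} (b : Fin m → ℝ) (s : Fin n → ℝ) : ℕ :=
  if ∃ (i : Fin m) (j : Fin n), (i : ℕ) + 1 = tradeSize b s ∧ (j : ℕ) = tradeSize b s ∧
      s (sellerOrder s j) ≤ b (buyerOrder b i)
  then tradeSize b s
  else tradeSize b s - 1

/-- The allocation chosen by Seller Trade Reduction. (Its payments are transfers between the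
agents and do not enter the welfare.) -/
noncomputable def strAllocation {m n : ℕ} (b : Fin m → ℝ) (s : Fin n → ℝ) : Allocation m n :=
  tradeTop b s (strTradeSize b s)

/-- The expected value of a non-negative quantity `W b s`, where the `m` buyer values `b` are
i.i.d. from `FB`, the `n` seller values `s` are i.i.d. from `FS`, and all are independent.
It may be infinite. -/
noncomputable def expected (FB FS : Measure ℝ) (m n : ℕ)
    (W : (Fin m → ℝ) → (Fin n → ℝ) → ℝ) : ENNReal :=
  ∫⁻ v : (Fin m → ℝ) × (Fin n → ℝ), ENNReal.ofReal (W v.1 v.2)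
    ∂((Measure.pi fun _ : Fin m => FB).prod (Measure.pi fun _ : Fin n => FS))

/-- Expected welfare of the optimal allocation with `m` buyers and `n` sellers. -/
noncomputable def optWelfare (FB FS : Measure ℝ) (m n : ℕ) : ENNReal :=
  expected FB FS m n fun b s => welfare b s (firstBest b s)

/-- Expected welfare of Seller Trade Reduction with `m` buyers and `n` sellers. -/
noncomputable def strWelfare (FB FS : Measure ℝ) (m n : ℕ) : ENNReal :=
  expected FB FS m n fun b s => welfare b s (strAllocation b s)

/-! The first-best allocation is a feasible allocation of maximal welfare. -/

theorem bddAbove_trades {m n : ℕ} (b : Fin m → ℝ) (s : Fin n → ℝ) :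
    BddAbove {k : ℕ | ∃ (i : Fin m) (j : Fin n), (i : ℕ) + 1 = k ∧ (j : ℕ) + 1 = k ∧
      s (sellerOrder s j) ≤ b (buyerOrder b i)} := by
  refine ⟨m, ?_⟩
  rintro k ⟨i, j, hi, -, -⟩
  have := i.2
  omega

theorem tradeSize_spec {m n : ℕ} (b : Fin m → ℝ) (s : Fin n → ℝ) (h : 0 < tradeSize b s) :
    ∃ (i : Fin m) (j : Fin n), (i : ℕ) + 1 = tradeSize b s ∧ (j : ℕ) + 1 = tradeSize b s ∧
      s (sellerOrder s j) ≤ b (buyerOrder b i) := by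
  refine Nat.sSup_mem (s := {k : ℕ | ∃ (i : Fin m) (j : Fin n), (i : ℕ) + 1 = k ∧
    (j : ℕ) + 1 = k ∧ s (sellerOrder s j) ≤ b (buyerOrder b i)}) ?_ (bddAbove_trades b s)
  by_contra hne
  rw [Set.not_nonempty_iff_eq_empty] at hne
  rw [tradeSize, hne] at h
  simp at h

theorem tradeSize_le {m n : ℕ} (b : Fin m → ℝ) (s : Fin n → ℝ) :
    tradeSize b s ≤ m ∧ tradeSize b s ≤ n := by
  rcases Nat.eq_zero_or_pos (tradeSize b s) with h | h
  · omega
  · obtain ⟨i, j, hi, hj, -⟩ := tradeSize_spec b s h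
    have := i.2
    have := j.2
    omega

theorem lt_of_tradeSize_eq {m n : ℕ} (b : Fin m → ℝ) (s : Fin n → ℝ) (i : Fin m) (j : Fin n)
    (hi : (i : ℕ) = tradeSize b s) (hj : (j : ℕ) = tradeSize b s) :
    b (buyerOrder b i) < s (sellerOrder s j) := by
  by_contra hlt
  have : tradeSize b s + 1 ≤ tradeSize b s :=
    le_csSup (bddAbove_trades b s) ⟨i, j, by omega, by omega, not_lt.mp hlt⟩
  omega

theorem buyerOrder_anti {m : ℕ} (b : Fin m → ℝ) : Antitone (fun k => b (buyerOrder b k)) := by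
  intro k l hkl
  have := Tuple.monotone_sort (fun i => -b i) hkl
  simpa [buyerOrder] using this

theorem sellerOrder_mono {n : ℕ} (s : Fin n → ℝ) : Monotone (fun k => s (sellerOrder s k)) :=
  Tuple.monotone_sort s

theorem card_rank_lt {m k : ℕ} (e : Equiv.Perm (Fin m)) (h : k ≤ m) :
    (Finset.univ.filter fun i => ((e.symm i : Fin m) : ℕ) < k).card = k := by
  have : (Finset.univ.filter fun i => ((e.symm i : Fin m) : ℕ) < k)
      = (Finset.univ.filter fun i : Fin m => (i : ℕ) < k).map e.toEmbedding := by
    ext i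
    simp
  rw [this, Finset.card_map, Fin.card_filter_val_lt]
  omega

theorem tradeTop_feasible {m n : ℕ} (b : Fin m → ℝ) (s : Fin n → ℝ) {k : ℕ}
    (hm : k ≤ m) (hn : k ≤ n) : (tradeTop b s k).Feasible := by
  simp only [Allocation.Feasible, tradeTop]
  rw [card_rank_lt _ hm, card_rank_lt _ hn]

theorem firstBest_feasible {m n : ℕ} (b : Fin m → ℝ) (s : Fin n → ℝ) :
    (firstBest b s).Feasible :=
  tradeTop_feasible b s (tradeSize_le b s).1 (tradeSize_le b s).2

theorem strAllocation_feasible {m n : ℕ} (b : Fin m → ℝ) (s : Fin n → ℝ) :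
    (strAllocation b s).Feasible := by
  have h := tradeSize_le b s
  have h' : strTradeSize b s ≤ tradeSize b s := by
    unfold strTradeSize
    split_ifs <;> omega
  exact tradeTop_feasible b s (by omega) (by omega)

theorem exists_price {m n : ℕ} (b : Fin m → ℝ) (s : Fin n → ℝ) :
    ∃ t : ℝ, (∀ i, i ∈ (firstBest b s).buyers → t ≤ b i) ∧
      (∀ i, i ∉ (firstBest b s).buyers → b i ≤ t) ∧
      (∀ j, j ∈ (firstBest b s).sellers → s j ≤ t) ∧
      (∀ j, j ∉ (firstBest b s).sellers → t ≤ s j) := by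
  have hbb : ∀ i i', i ∈ (firstBest b s).buyers → i' ∉ (firstBest b s).buyers → b i' ≤ b i := by
    intro i i' hi hi'
    simp only [firstBest, tradeTop, Finset.mem_filter, Finset.mem_univ, true_and] at hi hi'
    have := buyerOrder_anti b
      (show (buyerOrder b).symm i ≤ (buyerOrder b).symm i' from Fin.le_def.2 (by omega))
    simpa using this
  have hss : ∀ j j', j ∈ (firstBest b s).sellers → j' ∉ (firstBest b s).sellers →
      s j ≤ s j' := by
    intro j j' hj hj'
    simp only [firstBest, tradeTop, Finset.mem_filter, Finset.mem_univ, true_and] at hj hj'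
    have := sellerOrder_mono s
      (show (sellerOrder s).symm j ≤ (sellerOrder s).symm j' from Fin.le_def.2 (by omega))
    simpa using this
  have hsb : ∀ i j, i ∈ (firstBest b s).buyers → j ∈ (firstBest b s).sellers → s j ≤ b i := by
    intro i j hi hj
    simp only [firstBest, tradeTop, Finset.mem_filter, Finset.mem_univ, true_and] at hi hj
    obtain ⟨i₀, j₀, hi₀, hj₀, h⟩ := tradeSize_spec b s (by omega)
    have h1 := buyerOrder_anti b
      (show (buyerOrder b).symm i ≤ i₀ from Fin.le_def.2 (by omega))
    have h2 := sellerOrder_mono s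
      (show (sellerOrder s).symm j ≤ j₀ from Fin.le_def.2 (by omega))
    simp only [Equiv.apply_symm_apply] at h1 h2
    linarith
  have hbs : ∀ i j, i ∉ (firstBest b s).buyers → j ∉ (firstBest b s).sellers → b i ≤ s j := by
    intro i j hi hj
    simp only [firstBest, tradeTop, Finset.mem_filter, Finset.mem_univ, true_and] at hi hj
    have hi' := ((buyerOrder b).symm i).2
    have hj' := ((sellerOrder s).symm j).2
    have h := lt_of_tradeSize_eq b s ⟨tradeSize b s, by omega⟩ ⟨tradeSize b s, by omega⟩ rfl rfl
    have h1 := buyerOrder_anti b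
      (show ⟨tradeSize b s, by omega⟩ ≤ (buyerOrder b).symm i from Fin.le_def.2 (by simp; omega))
    have h2 := sellerOrder_mono s
      (show ⟨tradeSize b s, by omega⟩ ≤ (sellerOrder s).symm j from Fin.le_def.2 (by simp; omega))
    simp only [Equiv.apply_symm_apply] at h1 h2
    linarith
  let L : Finset ℝ := (firstBest b s).sellers.image s ∪ (firstBest b s).buyersᶜ.image b
  let U : Finset ℝ := (firstBest b s).buyers.image b ∪ (firstBest b s).sellersᶜ.image s
  have hLU : ∀ x ∈ L, ∀ y ∈ U, x ≤ y := by
    intro x hx y hy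
    simp only [L, U, Finset.mem_union, Finset.mem_image, Finset.mem_compl] at hx hy
    rcases hx with ⟨j, hj, rfl⟩ | ⟨i, hi, rfl⟩ <;> rcases hy with ⟨i', hi', rfl⟩ | ⟨j', hj', rfl⟩
    · exact hsb _ _ hi' hj
    · exact hss _ _ hj hj'
    · exact hbb _ _ hi' hi
    · exact hbs _ _ hi hj'
  obtain ⟨t, htL, htU⟩ : ∃ t : ℝ, (∀ x ∈ L, x ≤ t) ∧ ∀ y ∈ U, t ≤ y := by
    rcases L.eq_empty_or_nonempty with h | h
    · rcases U.eq_empty_or_nonempty with h' | h'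
      · exact ⟨0, by simp [h], by simp [h']⟩
      · exact ⟨U.min' h', by simp [h], fun y hy => U.min'_le y hy⟩
    · exact ⟨L.max' h, fun x hx => L.le_max' x hx, fun y hy => hLU _ (L.max'_mem h) y hy⟩
  refine ⟨t, fun i hi => htU _ ?_, fun i hi => htL _ ?_, fun j hj => htL _ ?_,
    fun j hj => htU _ ?_⟩
  · exact Finset.mem_union_left _ (Finset.mem_image_of_mem b hi)
  · exact Finset.mem_union_right _ (Finset.mem_image_of_mem b (Finset.mem_compl.2 hi))
  · exact Finset.mem_union_left _ (Finset.mem_image_of_mem s hj)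
  · exact Finset.mem_union_right _ (Finset.mem_image_of_mem s (Finset.mem_compl.2 hj))

theorem welfare_eq {m n : ℕ} (b : Fin m → ℝ) (s : Fin n → ℝ) (A : Allocation m n)
    (hA : A.Feasible) (t : ℝ) :
    welfare b s A = ∑ i ∈ A.buyers, (b i - t) + ∑ j ∈ A.sellersᶜ, (s j - t) + n * t := by
  have h : ((A.sellersᶜ).card : ℝ) = n - A.sellers.card := by
    rw [Finset.card_compl, Nat.cast_sub (Finset.card_le_univ _), Fintype.card_fin]
  unfold Allocation.Feasible at hA
  simp only [welfare, Finset.sum_sub_distrib, Finset.sum_const, nsmul_eq_mul, h, hA]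
  ring

theorem sum_le_of_sign {ι : Type*} [Fintype ι] [DecidableEq ι] (f : ι → ℝ) (P Q : Finset ι)
    (h1 : ∀ i, i ∈ P → 0 ≤ f i) (h2 : ∀ i, i ∉ P → f i ≤ 0) :
    ∑ i ∈ Q, f i ≤ ∑ i ∈ P, f i := by
  have hQ : ∑ i ∈ Q, f i = ∑ i, if i ∈ Q then f i else 0 := by simp
  have hP : ∑ i ∈ P, f i = ∑ i, if i ∈ P then f i else 0 := by simp
  rw [hQ, hP]
  refine Finset.sum_le_sum fun i _ => ?_
  by_cases hq : i ∈ Q <;> by_cases hp : i ∈ P <;> simp only [hq, hp, if_true, if_false]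
  · exact le_refl _
  · exact h2 i hp
  · exact h1 i hp
  · exact le_refl _

theorem welfare_le_firstBest {m n : ℕ} (b : Fin m → ℝ) (s : Fin n → ℝ) (A : Allocation m n)
    (hA : A.Feasible) : welfare b s A ≤ welfare b s (firstBest b s) := by
  obtain ⟨t, h1, h2, h3, h4⟩ := exists_price b s
  rw [welfare_eq b s A hA t, welfare_eq b s _ (firstBest_feasible b s) t]
  have e1 := sum_le_of_sign (fun i => b i - t) (firstBest b s).buyers A.buyers
    (fun i hi => sub_nonneg.2 (h1 i hi)) (fun i hi => sub_nonpos.2 (h2 i hi))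
  have e2 := sum_le_of_sign (fun j => s j - t) (firstBest b s).sellersᶜ A.sellersᶜ
    (fun j hj => sub_nonneg.2 (h4 j (Finset.mem_compl.1 hj)))
    (fun j hj => sub_nonpos.2 (h3 j (by simpa using hj)))
  linarith

end DoubleAuction

/-!
One extra buyer and one extra seller suffice, and the inequality already holds profile by profile.
With `n + 1` items the optimal allocation keeps the `n + 1` highest values of the whole market.
Seller Trade Reduction either keeps them all, and then adding agents has only helped, or it drops
the trade between the `r`-th highest buyer and the `r`-th lowest seller. It does so only if every
seller ranked after the `r`-th values her item at more than the `r`-th buyer does; hence that buyer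
has the lowest of the `n + 1` values kept by the optimal allocation, and the agents who still hold an
item have the `n` highest values of the large market, apart from one more non-negative value. No
allocation of `n` items in a sub-market can exceed that
(`welfare_comp_le_strAllocation`; the `r`-th buyer's value serves as the separating price).

The expectations are compared by forgetting the first buyer and the first seller, which preserves
the product measures (`measurePreserving_tail_prod`). As `lintegral_map_le` holds for arbitrary
integrands, the measurability of the welfare plays no role.
-/

namespace DoubleAuction

/-- The allocation of a larger market, whose agents contain those of a smaller one via `f` and `g`,
in which the additional agents do not trade. -/
def Allocation.map {m n m' n' : ℕ} (A : Allocation m n) (f : Fin m ↪ Fin m')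
    (g : Fin n ↪ Fin n') : Allocation m' n' where
  buyers := A.buyers.map f
  sellers := A.sellers.map g

theorem Allocation.Feasible.map {m n m' n' : ℕ} {A : Allocation m n} (hA : A.Feasible)
    (f : Fin m ↪ Fin m') (g : Fin n ↪ Fin n') : (A.map f g).Feasible := by
  simpa [Allocation.Feasible, Allocation.map] using hA

theorem welfare_comp_le_welfare_map {m n m' n' : ℕ} (b : Fin m' → ℝ) (s : Fin n' → ℝ)
    (hs : ∀ j, 0 ≤ s j) (A : Allocation m n) (f : Fin m ↪ Fin m') (g : Fin n ↪ Fin n') :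
    welfare (b ∘ f) (s ∘ g) A ≤ welfare b s (A.map f g) := by
  have hsub : A.sellersᶜ.map g ⊆ (A.sellers.map g)ᶜ := by
    intro j hj
    obtain ⟨i, hi, rfl⟩ := Finset.mem_map.1 hj
    simpa using hi
  have h := Finset.sum_le_sum_of_subset_of_nonneg hsub (f := s) fun j _ _ => hs j
  rw [Finset.sum_map] at h
  simpa [welfare, Allocation.map] using h

/-- If the `r`-th buyer's value `t` lies between the `r`-th and the `(r + 1)`-st lowest seller
values, then the `r - 1` best trades of a market with `n + 1` sellers give at least the welfare of
every feasible allocation of a sub-market with `n` sellers: with `t` as a price, those who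
then hold an item are the agents whose values exceed `t`, up to ties and one more seller. -/
theorem welfare_comp_le_tradeTop {m n m' : ℕ} (b : Fin m' → ℝ) (s : Fin (n + 1) → ℝ)
    (hs : ∀ j, 0 ≤ s j) (A : Allocation m n) (hA : A.Feasible) (f : Fin m ↪ Fin m')
    (g : Fin n ↪ Fin (n + 1)) (i₀ : Fin m') (j₀ : Fin (n + 1)) (hij : (i₀ : ℕ) = j₀)
    (hle : s (sellerOrder s j₀) ≤ b (buyerOrder b i₀))
    (hlt : ∀ j, j₀ < j → b (buyerOrder b i₀) ≤ s (sellerOrder s j)) :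
    welfare (b ∘ f) (s ∘ g) A ≤ welfare b s (tradeTop b s i₀) := by
  set t := b (buyerOrder b i₀)
  set B := (tradeTop b s i₀).buyers with hB
  set S := (tradeTop b s i₀).sellers with hS
  set S' := (tradeTop b s (i₀ + 1)).sellers with hS'
  have hBuy : ∑ i ∈ A.buyers.map f, (b i - t) ≤ ∑ i ∈ B, (b i - t) := by
    refine sum_le_of_sign (fun i => b i - t) B _ (fun i hi => ?_) fun i hi => ?_ <;>
      simp only [hB, tradeTop, Finset.mem_filter, Finset.mem_univ, true_and, not_lt] at hi
    · have := buyerOrder_anti b (show (buyerOrder b).symm i ≤ i₀ from Fin.le_def.2 hi.le)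
      simpa using this
    · have := buyerOrder_anti b (show i₀ ≤ (buyerOrder b).symm i from Fin.le_def.2 hi)
      simpa using this
  have hSell : ∑ j ∈ A.sellersᶜ.map g, (s j - t) ≤ ∑ j ∈ S'ᶜ, (s j - t) := by
    refine sum_le_of_sign (fun j => s j - t) S'ᶜ _ (fun j hj => ?_) fun j hj => ?_ <;>
      simp only [hS', tradeTop, Finset.mem_compl, Finset.mem_filter, Finset.mem_univ, true_and,
        not_not] at hj
    · have := hlt ((sellerOrder s).symm j) (Fin.lt_def.2 (by omega))
      simpa using this
    · have := sellerOrder_mono s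
        (show (sellerOrder s).symm j ≤ j₀ from Fin.le_def.2 (by omega))
      simp only [Equiv.apply_symm_apply] at this
      linarith
  have hj₀ := j₀.2
  have hBcard : B.card = i₀ := card_rank_lt _ i₀.2.le
  have hS'card : (S'ᶜ.card : ℝ) = n - i₀ := by
    have : S'.card = i₀ + 1 := card_rank_lt _ (by omega)
    rw [Finset.card_compl, Fintype.card_fin, this, Nat.add_sub_add_right,
      Nat.cast_sub (by omega)]
  -- The seller of the dropped trade keeps her item; her value only adds to the welfare.
  have hdrop : ∑ j ∈ S'ᶜ, s j ≤ ∑ j ∈ Sᶜ, s j := by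
    refine Finset.sum_le_sum_of_subset_of_nonneg (Finset.compl_subset_compl.2 ?_)
      fun j _ _ => hs j
    intro j hj
    simp only [hS, hS', tradeTop, Finset.mem_filter, Finset.mem_univ, true_and] at hj ⊢
    omega
  rw [welfare_eq _ _ A hA t]
  simp only [Finset.sum_map, Finset.card_map, Finset.sum_sub_distrib, Finset.sum_const,
    nsmul_eq_mul, hBcard, hS'card] at hBuy hSell
  simp only [welfare, Function.comp_apply, Finset.sum_sub_distrib, Finset.sum_const, nsmul_eq_mul,
    ← hB, ← hS]
  linarith

/-- With at least one seller more, Seller Trade Reduction is at least as good as every feasible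
allocation of a sub-market, for each profile of values. -/
theorem welfare_comp_le_strAllocation {m n m' : ℕ} (b : Fin m' → ℝ) (s : Fin (n + 1) → ℝ)
    (hs : ∀ j, 0 ≤ s j) (A : Allocation m n) (hA : A.Feasible) (f : Fin m ↪ Fin m')
    (g : Fin n ↪ Fin (n + 1)) :
    welfare (b ∘ f) (s ∘ g) A ≤ welfare b s (strAllocation b s) := by
  have hfull := (welfare_comp_le_welfare_map b s hs A f g).trans
    (welfare_le_firstBest b s _ (hA.map f g))
  unfold strAllocation strTradeSize
  split_ifs with h
  · exact hfull
  rcases Nat.eq_zero_or_pos (tradeSize b s) with h0 | hpos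
  · -- Without trades there is none to drop: the truncated `r - 1` is `r`.
    rw [h0]
    simpa only [firstBest, h0] using hfull
  obtain ⟨i₀, j₀, hi, hj, hle⟩ := tradeSize_spec b s hpos
  rw [← hi, Nat.add_sub_cancel]
  refine welfare_comp_le_tradeTop b s hs A hA f g i₀ j₀ (by omega) hle fun j hlt => ?_
  have hj' := j.2
  rw [Fin.lt_def] at hlt
  have hnext : b (buyerOrder b i₀) < s (sellerOrder s ⟨tradeSize b s, by omega⟩) :=
    lt_of_not_ge fun hge => h ⟨i₀, ⟨tradeSize b s, by omega⟩, hi, rfl, hge⟩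
  exact hnext.le.trans (sellerOrder_mono s (Fin.le_def.2 (by simp only; omega)))

theorem measurePreserving_tail (F : Measure ℝ) [IsProbabilityMeasure F] (m : ℕ) :
    MeasurePreserving (fun b : Fin (m + 1) → ℝ => b ∘ Fin.succEmb m)
      (Measure.pi fun _ => F) (Measure.pi fun _ => F) :=
  measurePreserving_snd.comp (measurePreserving_piFinSuccAbove (fun _ => F) 0)

theorem measurePreserving_tail_prod (FB FS : Measure ℝ) [IsProbabilityMeasure FB]
    [IsProbabilityMeasure FS] (m n : ℕ) :
    MeasurePreserving
      (fun v : (Fin (m + 1) → ℝ) × (Fin (n + 1) → ℝ) =>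
        (v.1 ∘ Fin.succEmb m, v.2 ∘ Fin.succEmb n))
      ((Measure.pi fun _ => FB).prod (Measure.pi fun _ => FS))
      ((Measure.pi fun _ => FB).prod (Measure.pi fun _ => FS)) :=
  (measurePreserving_tail FB m).prod (measurePreserving_tail FS n)

theorem ae_sellers_nonneg (FB FS : Measure ℝ) [IsProbabilityMeasure FB]
    [IsProbabilityMeasure FS] (hFS : ∀ᵐ x ∂FS, 0 ≤ x) (m n : ℕ) :
    ∀ᵐ v : (Fin m → ℝ) × (Fin n → ℝ)
      ∂((Measure.pi fun _ => FB).prod (Measure.pi fun _ => FS)), ∀ j, 0 ≤ v.2 j :=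
  ae_all_iff.2 fun j => Measure.quasiMeasurePreserving_snd.ae
    ((Measure.quasiMeasurePreserving_eval (fun _ => FS) j).ae hFS)

theorem optWelfare_le_strWelfare_succ (FB FS : Measure ℝ) [IsProbabilityMeasure FB]
    [IsProbabilityMeasure FS] (hFS : ∀ᵐ x ∂FS, 0 ≤ x) (m n : ℕ) :
    optWelfare FB FS m n ≤ strWelfare FB FS (m + 1) (n + 1) := by
  unfold optWelfare strWelfare expected
  rw [← (measurePreserving_tail_prod FB FS m n).map_eq]
  refine (lintegral_map_le _ _).trans (lintegral_mono_ae ?_)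
  filter_upwards [ae_sellers_nonneg FB FS hFS (m + 1) (n + 1)] with v hv
  exact ENNReal.ofReal_le_ofReal
    (welfare_comp_le_strAllocation v.1 v.2 hv _ (firstBest_feasible _ _) _ _)

end DoubleAuction

theorem corollary2 :
    ∃ c : ℕ, 0 < c ∧
      ∀ (m n : ℕ), n ≤ m →
        ∀ (FB FS : MeasureTheory.Measure ℝ)
          [MeasureTheory.IsProbabilityMeasure FB] [MeasureTheory.IsProbabilityMeasure FS],
          (∀ᵐ x ∂FB, 0 ≤ x) → (∀ᵐ x ∂FS, 0 ≤ x) →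
          DoubleAuction.FSD FB FS →
            DoubleAuction.optWelfare FB FS m n ≤ DoubleAuction.strWelfare FB FS (m + c) (n + c) :=
  ⟨1, one_pos, fun m n _ FB FS _ _ _ hFS _ =>
    DoubleAuction.optWelfare_le_strWelfare_succ FB FS hFS m n⟩
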